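/- Let $n\ge 1$ and let $\mathbf e=(e_1,\dots,e_n)$ with each $e_i\in\{1,-1\}$. Put $\mathbf e(n)=(\epsilon_1,\dots,\epsilon_{2n})=(e_n,\dots,e_2,e_1,e_1,e_2,\dots,e_n)$, and let $$G(\mathbf e(n))=\langle x,y\mid wx=yw\rangle,\qquad w=x^{\epsilon_1}y^{\epsilon_2}x^{\epsilon_3}y^{\epsilon_4}\cdots x^{\epsilon_{2n-1}}y^{\epsilon_{2n}},$$ be the associated kmot group. Its Riley polynomial $\mathcal R(\lambda)\in\mathbb Z[\lambda]$ is the upper left entry $W_{11}$ of the matrix $$W=\begin{pmatrix}1&1\\0&1\end{pmatrix}^{\epsilon_1}\begin{pmatrix}1&0\\\lambda&1\end{pmatrix}^{\epsilon_2}\cdots\begin{pmatrix}1&1\\0&1\end{pmatrix}^{\epsilon_{2n-1}}\begin{pmatrix}1&0\\\lambda&1\end{pmatrix}^{\epsilon_{2n}}.$$ Let $g_0,g_1,\dots,g_{n+1}\in\mathbb Z[u]$ be defined by $g_0=g_1=1$ and $g_{k+1}(u)=e_k\,u\,g_k(u)-g_{k-1}(u)$ for $1\le k\le n$, and put $v^{\mathbf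 e}_n(u)=g_{n+1}(u)$. Then $\mathcal R(\lambda)$ is irreducible in $\mathbb Z[\lambda]$ if and only if $v^{\mathbf e}_n(u)$ is irreducible in $\mathbb Z[u]$. -/

import Mathlib

open Polynomial

noncomputable section

/-- The two generators `x`, `y` of a two-bridge kmot group. -/
inductive KmotGen where
  | x : KmotGen
  | y : KmotGen

/-- The data of a kmot presentation: an odd integer `α ≥ 3` and a symmetric sequence of signs
`ε₁, …, ε_{α-1}`.  The sign `ε_{i+1}` is stored as `sign i`, so that `Fin.rev` is `i ↦ α - i`
on the one-based indices. -/
structure KmotData where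
  α : ℕ
  odd_α : Odd α
  three_le_α : 3 ≤ α
  sign : Fin (α - 1) → ℤˣ
  symm_sign : ∀ i, sign i.rev = sign i

namespace KmotData

/-- The word `w = x^ε₁ y^ε₂ x^ε₃ y^ε₄ ⋯ x^ε_{α-2} y^ε_{α-1}` in the free group on `x, y`. -/
def word (D : KmotData) : FreeGroup KmotGen :=
  (List.ofFn fun i : Fin (D.α - 1) =>
    FreeGroup.of (if Even (i : ℕ) then KmotGen.x else KmotGen.y) ^ ((D.sign i : ℤˣ) : ℤ)).prod

/-- The kmot group `⟨x, y | w x = y w⟩`. -/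
abbrev group (D : KmotData) : Type :=
  PresentedGroup
    {D.word * FreeGroup.of KmotGen.x * (FreeGroup.of KmotGen.y * D.word)⁻¹}

/-- The parabolic matrices `ρ(x) = (1 1; 0 1)` and `ρ(y) = (1 0; λ 1)` over `ℤ[λ]`. -/
def parabolicGen : KmotGen → Matrix.SpecialLinearGroup (Fin 2) ℤ[X]
  | KmotGen.x => ⟨!![1, 1; 0, 1], by simp [Matrix.det_fin_two_of]⟩
  | KmotGen.y => ⟨!![1, 0; X, 1], by simp [Matrix.det_fin_two_of]⟩

/-- The matrix `W = ρ(w)`, with entries in `ℤ[λ]`. -/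
def W (D : KmotData) : Matrix.SpecialLinearGroup (Fin 2) ℤ[X] :=
  FreeGroup.lift parabolicGen D.word

/-- The Riley polynomial `W₁₁ ∈ ℤ[λ]`. -/
def rileyPolynomial (D : KmotData) : ℤ[X] :=
  (D.W : Matrix (Fin 2) (Fin 2) ℤ[X]) 0 0

/-- The kmot data of the symmetric sequence `e(n) = (e_n, …, e_2, e_1, e_1, e_2, …, e_n)`,
where `α = 2 n + 1`; the sequence `e` is one-based. -/
def ofHalf (n : ℕ) (hn : 1 ≤ n) (e : ℕ → ℤˣ) : KmotData where
  α := 2 * n + 1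
  odd_α := ⟨n, rfl⟩
  three_le_α := by omega
  sign := fun i => if (i : ℕ) < n then e (n - i) else e (i + 1 - n)
  symm_sign := by
    intro i
    have hi : (i : ℕ) < 2 * n := i.isLt
    have hr : (i.rev : ℕ) = 2 * n - 1 - i := by
      rw [Fin.val_rev]; omega
    rw [hr]
    by_cases h : (i : ℕ) < n
    · rw [if_neg (by omega), if_pos h]
      congr 1; omega
    · rw [if_pos (by omega), if_neg h]
      congr 1; omega

end KmotData

/-- The `e`-Chebyshev polynomials with initial values `g₀ = a`, `g₁ = b`, defined by
`g_{k+1}(t) = e_k t g_k(t) - g_{k-1}(t)` for `k ≥ 1`; the sequence `e` is one-based. -/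
def epsChebyshev (e : ℕ → ℤˣ) (a b : ℤ[X]) : ℕ → ℤ[X]
  | 0 => a
  | 1 => b
  | k + 2 => C ((e (k + 1) : ℤˣ) : ℤ) * X * epsChebyshev e a b (k + 1) - epsChebyshev e a b k

/-- The polynomial `v_n^e`, the `(n+1)`-st `e`-Chebyshev polynomial with initial values `1, 1`.
It depends only on `e_1, …, e_n`. -/
def epsV (e : ℕ → ℤˣ) (n : ℕ) : ℤ[X] :=
  epsChebyshev e 1 1 (n + 1)

end

/-!
Put `v = v_n^e`. After the substitution `λ = -u²` the Riley polynomial becomes `v(u) v(-u)`: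
conjugating by `diag(u, 1)` turns `x^ε` into `U(ε) = (1 εu; 0 1)` and `y^ε` into `S U(ε) S⁻¹`, where
`S = (0 -1; 1 0)` and `U(ε) S = (εu -1; 1 0)` is the matrix of one step of the Chebyshev recursion.
The factors `S` telescope, and up to sign the word becomes the palindromic product of these
matrices, whose upper left entry is `p² - q² = (p + q)(p - q)` with `v = p + q`, where `p` and `q`
have opposite parities.

A factorization `v = a b` gives the factorization of `v(u) v(-u)` into the norms `a(u) a(-u)` and
`b(u) b(-u)`, which are polynomials in `-u²`. Conversely, a proper factorization of `v(u) v(-u)`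
with irreducible `v` separates `v(u)` from `v(-u)` up to units, so its factors cannot both be
polynomials in `-u²` unless `v` is even, and `v` is not even because `p` and `q` are nonzero.
-/

section EvenPolynomials

variable {R : Type*} [CommRing R]

theorem comp_neg_X_sq_eq_expand (p : R[X]) : p.comp (-X ^ 2) = expand R 2 (p.comp (-X)) := by
  rw [expand_eq_comp_X_pow, comp_assoc, neg_comp, X_comp]

theorem comp_neg_X_sq_injective : Function.Injective fun p : R[X] => p.comp (-X ^ 2) := by
  intro p q h
  simp only [comp_neg_X_sq_eq_expand] at h
  rw [← comp_neg_X_comp_neg_X p, expand_injective two_pos h, comp_neg_X_comp_neg_X]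

theorem comp_neg_X_sq_comp_neg_X (p : R[X]) :
    (p.comp (-X ^ 2)).comp (-X) = p.comp (-X ^ 2) := by
  simp [comp_assoc]

theorem isUnit_comp_neg_X_iff {p : R[X]} : IsUnit (p.comp (-X)) ↔ IsUnit p :=
  MulEquiv.isUnit_map (algEquivAevalNegX (R := R))

theorem irreducible_comp_neg_X_iff {p : R[X]} : Irreducible (p.comp (-X)) ↔ Irreducible p :=
  MulEquiv.irreducible_iff (algEquivAevalNegX (R := R))

theorem isUnit_comp_neg_X_sq_iff [IsDomain R] {p : R[X]} :
    IsUnit (p.comp (-X ^ 2)) ↔ IsUnit p := by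
  have := isLocalHom_expand R two_pos
  rw [comp_neg_X_sq_eq_expand, isUnit_map_iff, isUnit_comp_neg_X_iff]

theorem exists_eq_comp_neg_X_sq_add_X_mul (a : R[X]) :
    ∃ p q : R[X], a = p.comp (-X ^ 2) + X * q.comp (-X ^ 2) := by
  induction a using recOnHorner with
  | M0 => exact ⟨0, 0, by simp⟩
  | MC a r _ _ ih =>
    obtain ⟨p, q, rfl⟩ := ih
    exact ⟨p + C r, q, by simp only [add_comp, C_comp]; ring⟩
  | MX a _ ih =>
    obtain ⟨p, q, rfl⟩ := ih
    exact ⟨-X * q, p, by simp only [mul_comp, neg_comp, X_comp]; ring⟩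

theorem exists_comp_neg_X_sq_eq_mul_comp_neg_X (a : R[X]) :
    ∃ b : R[X], b.comp (-X ^ 2) = a * a.comp (-X) := by
  obtain ⟨p, q, rfl⟩ := exists_eq_comp_neg_X_sq_add_X_mul a
  refine ⟨p ^ 2 + X * q ^ 2, ?_⟩
  simp only [add_comp, mul_comp, pow_comp, X_comp, comp_neg_X_sq_comp_neg_X]
  ring

end EvenPolynomials

section IrreducibilityCriterion

variable {R : Type*} [CommRing R] [IsDomain R] {f v : R[X]}

theorem irreducible_of_comp_neg_X_sq_eq (hfv : f.comp (-X ^ 2) = v * v.comp (-X))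
    (hf : Irreducible f) : Irreducible v := by
  refine ⟨fun hv => hf.not_isUnit ?_, fun a b hab => ?_⟩
  · rw [← isUnit_comp_neg_X_sq_iff, hfv]
    exact hv.mul (isUnit_comp_neg_X_iff.2 hv)
  · obtain ⟨A, hA⟩ := exists_comp_neg_X_sq_eq_mul_comp_neg_X a
    obtain ⟨B, hB⟩ := exists_comp_neg_X_sq_eq_mul_comp_neg_X b
    have hfAB : f = A * B := comp_neg_X_sq_injective <| by
      simp only [mul_comp, hA, hB, hfv, hab]
      ring
    refine (hf.isUnit_or_isUnit hfAB).imp (fun h => ?_) (fun h => ?_)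
    · exact isUnit_of_mul_isUnit_left (hA ▸ isUnit_comp_neg_X_sq_iff.2 h)
    · exact isUnit_of_mul_isUnit_left (hB ▸ isUnit_comp_neg_X_sq_iff.2 h)

theorem comp_neg_X_eq_self_of_mul_isUnit {a c : R[X]} (hc : IsUnit c)
    (h : a.comp (-X ^ 2) = v * c) : v.comp (-X) = v := by
  obtain ⟨r, -, rfl⟩ := Polynomial.isUnit_iff.1 hc
  have h_even := comp_neg_X_sq_comp_neg_X a
  rw [h, mul_comp, C_comp] at h_even
  exact mul_right_cancel₀ hc.ne_zero h_even

theorem isUnit_of_irreducible_dvd_comp_neg_X_sq {a b : R[X]} (hv : Irreducible v)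
    (hne : v.comp (-X) ≠ v) (hab : a.comp (-X ^ 2) * b.comp (-X ^ 2) = v * v.comp (-X))
    (hdvd : v ∣ a.comp (-X ^ 2)) : IsUnit b := by
  obtain ⟨c, hc⟩ := hdvd
  have hcb : v.comp (-X) = c * b.comp (-X ^ 2) := by
    rw [hc, mul_assoc] at hab
    exact (mul_left_cancel₀ hv.ne_zero hab).symm
  rcases (irreducible_comp_neg_X_iff.2 hv).isUnit_or_isUnit hcb with hu | hu
  · exact absurd (comp_neg_X_eq_self_of_mul_isUnit hu hc) hne
  · exact isUnit_comp_neg_X_sq_iff.1 hu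

theorem irreducible_of_prime_of_comp_neg_X_sq_eq (hfv : f.comp (-X ^ 2) = v * v.comp (-X))
    (hne : v.comp (-X) ≠ v) (hv : Prime v) : Irreducible f := by
  refine ⟨fun hf => hv.not_isUnit ?_, fun a b hab => ?_⟩
  · exact isUnit_of_mul_isUnit_left (hfv ▸ isUnit_comp_neg_X_sq_iff.2 hf)
  · rw [hab, mul_comp] at hfv
    rcases hv.dvd_or_dvd (Dvd.intro _ hfv.symm) with hva | hvb
    · exact .inr (isUnit_of_irreducible_dvd_comp_neg_X_sq hv.irreducible hne hfv hva)
    · rw [mul_comm] at hfv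
      exact .inl (isUnit_of_irreducible_dvd_comp_neg_X_sq hv.irreducible hne hfv hvb)

theorem irreducible_iff_of_comp_neg_X_sq_eq [UniqueFactorizationMonoid R]
    (hfv : f.comp (-X ^ 2) = v * v.comp (-X)) (hne : v.comp (-X) ≠ v) :
    Irreducible f ↔ Irreducible v :=
  ⟨irreducible_of_comp_neg_X_sq_eq hfv,
    fun hv => irreducible_of_prime_of_comp_neg_X_sq_eq hfv hne hv.prime⟩

end IrreducibilityCriterion

section EpsChebyshev

theorem epsChebyshev_add_two (e : ℕ → ℤˣ) (a b : ℤ[X]) (k : ℕ) :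
    epsChebyshev e a b (k + 2) =
      C (e (k + 1) : ℤ) * X * epsChebyshev e a b (k + 1) - epsChebyshev e a b k :=
  rfl

theorem epsChebyshev_eq_add (e : ℕ → ℤˣ) (a b : ℤ[X]) (k : ℕ) :
    epsChebyshev e a b k = a * epsChebyshev e 1 0 k + b * epsChebyshev e 0 1 k := by
  induction k using Nat.twoStepInduction with
  | zero => simp [epsChebyshev]
  | one => simp [epsChebyshev]
  | more k ih₀ ih₁ =>
    simp only [epsChebyshev_add_two]
    rw [ih₀, ih₁]
    ring

theorem epsChebyshev_comp_neg_X (e : ℕ → ℤˣ) (a b : ℤ[X]) (k : ℕ) :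
    (epsChebyshev e a b k).comp (-X) =
      (-1) ^ (k + 1) * epsChebyshev e (-a.comp (-X)) (b.comp (-X)) k := by
  induction k using Nat.twoStepInduction with
  | zero => simp [epsChebyshev]
  | one => simp [epsChebyshev]
  | more k ih₀ ih₁ =>
    simp only [epsChebyshev_add_two, sub_comp, mul_comp, C_comp, X_comp, ih₀, ih₁]
    ring

theorem epsV_comp_neg_X (e : ℕ → ℤˣ) (n : ℕ) :
    (epsV e n).comp (-X) = (-1) ^ n * epsChebyshev e (-1) 1 (n + 1) := by
  rw [epsV, epsChebyshev_comp_neg_X, one_comp]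
  ring

theorem degree_lt_degree_epsChebyshev_add_two {e : ℕ → ℤˣ} {a b : ℤ[X]} {k : ℕ}
    (hdeg : (epsChebyshev e a b k).degree ≤ (epsChebyshev e a b (k + 1)).degree)
    (hne : epsChebyshev e a b (k + 1) ≠ 0) :
    (epsChebyshev e a b (k + 1)).degree < (epsChebyshev e a b (k + 2)).degree := by
  have hlt : (epsChebyshev e a b (k + 1)).degree <
      (C (e (k + 1) : ℤ) * X * epsChebyshev e a b (k + 1)).degree := by
    rw [mul_assoc, degree_C_mul (e (k + 1)).ne_zero, mul_comm X]
    exact degree_lt_degree_mul_X hne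
  rwa [epsChebyshev_add_two, degree_sub_eq_left_of_degree_lt (hdeg.trans_lt hlt)]

theorem epsChebyshev_ne_zero_of_le {e : ℕ → ℤˣ} {a b : ℤ[X]} {m k : ℕ} (hmk : m ≤ k)
    (hdeg : (epsChebyshev e a b m).degree ≤ (epsChebyshev e a b (m + 1)).degree)
    (hne : epsChebyshev e a b (m + 1) ≠ 0) : epsChebyshev e a b (k + 1) ≠ 0 := by
  suffices h : (epsChebyshev e a b k).degree ≤ (epsChebyshev e a b (k + 1)).degree ∧
      epsChebyshev e a b (k + 1) ≠ 0 from h.2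
  induction k, hmk using Nat.le_induction with
  | base => exact ⟨hdeg, hne⟩
  | succ k _ ih =>
    have hlt := degree_lt_degree_epsChebyshev_add_two ih.1 ih.2
    exact ⟨hlt.le, ne_zero_of_degree_gt hlt⟩

theorem epsChebyshev_zero_one_ne_zero (e : ℕ → ℤˣ) (n : ℕ) : epsChebyshev e 0 1 (n + 1) ≠ 0 :=
  epsChebyshev_ne_zero_of_le n.zero_le (by simp [epsChebyshev]) (by simp [epsChebyshev])

theorem epsChebyshev_one_zero_ne_zero (e : ℕ → ℤˣ) {n : ℕ} (hn : 1 ≤ n) :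
    epsChebyshev e 1 0 (n + 1) ≠ 0 :=
  epsChebyshev_ne_zero_of_le hn (by simp [epsChebyshev]) (by simp [epsChebyshev])

theorem comp_neg_X_epsV_ne {n : ℕ} (hn : 1 ≤ n) (e : ℕ → ℤˣ) :
    (epsV e n).comp (-X) ≠ epsV e n := by
  have hp := epsChebyshev_zero_one_ne_zero e n
  have hq := epsChebyshev_one_zero_ne_zero e hn
  rw [epsV_comp_neg_X, epsV, epsChebyshev_eq_add e (-1), epsChebyshev_eq_add e 1 1]
  intro h
  rcases neg_one_pow_eq_or ℤ[X] n with hs | hs <;> rw [hs] at h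
  · exact hq (self_eq_neg.1 (by linear_combination -h))
  · exact hp (self_eq_neg.1 (by linear_combination -h))

end EpsChebyshev

section TransferMatrix

/-- The matrix of one step `(g_k, g_{k-1}) ↦ (g_{k+1}, g_k)` of the Chebyshev recursion with
sign `ε`. -/
noncomputable def transferMatrix (ε : ℤˣ) : Matrix (Fin 2) (Fin 2) ℤ[X] :=
  !![C (ε : ℤ) * X, -1; 1, 0]

/-- The palindromic product `T(e_n) ⋯ T(e_1) T(e_1) ⋯ T(e_n)` of the transfer matrices
`T = transferMatrix`. -/
noncomputable def palindromicTransfer (e : ℕ → ℤˣ) : ℕ → Matrix (Fin 2) (Fin 2) ℤ[X]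
  | 0 => 1
  | n + 1 => transferMatrix (e (n + 1)) * palindromicTransfer e n * transferMatrix (e (n + 1))

theorem palindromicTransfer_eq (e : ℕ → ℤˣ) (n : ℕ) :
    palindromicTransfer e n =
      let p := epsChebyshev e 0 1
      let q := epsChebyshev e 1 0
      !![p (n + 1) ^ 2 - q (n + 1) ^ 2, q (n + 1) * q n - p (n + 1) * p n;
        p (n + 1) * p n - q (n + 1) * q n, q n ^ 2 - p n ^ 2] := by
  induction n with
  | zero => simp [palindromicTransfer, epsChebyshev, Matrix.one_fin_two]
  | succ n ih =>
    simp only [palindromicTransfer, ih, transferMatrix, epsChebyshev_add_two, Matrix.mul_fin_two]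
    congrm !![?_, ?_; ?_, ?_] <;> ring

theorem palindromicTransfer_apply_zero_zero (e : ℕ → ℤˣ) (n : ℕ) :
    palindromicTransfer e n 0 0 = (-1) ^ n * (epsV e n * (epsV e n).comp (-X)) := by
  have hsign : ((-1) ^ n * (-1) ^ n : ℤ[X]) = 1 := by rw [← mul_pow]; simp
  rw [epsV_comp_neg_X, epsV, epsChebyshev_eq_add e (-1), epsChebyshev_eq_add e 1 1,
    palindromicTransfer_eq]
  simp only [Matrix.of_apply, Matrix.cons_val_zero]
  linear_combination (epsChebyshev e 1 0 (n + 1) ^ 2 - epsChebyshev e 0 1 (n + 1) ^ 2) * hsign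

/-- The sign sequence `(e_n, …, e_2, e_1, e_1, e_2, …, e_n)` of length `2 n`, indexed from `0`. -/
def palindrome (e : ℕ → ℤˣ) (n i : ℕ) : ℤˣ :=
  if i < n then e (n - i) else e (i + 1 - n)

theorem palindrome_succ_zero (e : ℕ → ℤˣ) (n : ℕ) : palindrome e (n + 1) 0 = e (n + 1) := by
  simp [palindrome]

theorem palindrome_succ_succ (e : ℕ → ℤˣ) (n i : ℕ) :
    palindrome e (n + 1) (i + 1) = palindrome e n i := by
  simp [palindrome]

theorem palindrome_two_mul (e : ℕ → ℤˣ) (n : ℕ) : palindrome e n (2 * n) = e (n + 1) := by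
  rw [palindrome, if_neg (by omega), two_mul, add_assoc, Nat.add_sub_cancel_left]

theorem prod_ofFn_transferMatrix_palindrome (e : ℕ → ℤˣ) (n : ℕ) :
    (List.ofFn fun i : Fin (2 * n) => transferMatrix (palindrome e n i)).prod =
      palindromicTransfer e n := by
  induction n with
  | zero => simp [palindromicTransfer]
  | succ n ih =>
    change (List.ofFn fun i : Fin (2 * n + 1 + 1) => transferMatrix (palindrome e (n + 1) i)).prod =
      _
    rw [List.ofFn_succ, List.ofFn_succ_last, List.prod_cons, List.prod_append, List.prod_singleton]
    simp only [Fin.val_zero, Fin.val_succ, Fin.val_castSucc, Fin.val_last, palindrome_succ_zero,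
      palindrome_succ_succ, palindrome_two_mul, ih, palindromicTransfer, mul_assoc]

end TransferMatrix

section Riley

/-- The parabolic representation of the free group on `x, y` after the substitution `λ = -u²`, as a
homomorphism into the monoid of all matrices. -/
noncomputable def parabolicRep : FreeGroup KmotGen →* Matrix (Fin 2) (Fin 2) ℤ[X] :=
  (compRingHom (-X ^ 2)).mapMatrix.toMonoidHom.comp
    (Matrix.SpecialLinearGroup.coeMonoidHom.comp (FreeGroup.lift KmotData.parabolicGen))

theorem parabolicRep_of_zpow (g : KmotGen) (m : ℤ) :
    parabolicRep (FreeGroup.of g ^ m) =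
      ((KmotData.parabolicGen g ^ m : Matrix.SpecialLinearGroup (Fin 2) ℤ[X]) :
        Matrix (Fin 2) (Fin 2) ℤ[X]).map fun p => p.comp (-X ^ 2) := by
  rw [← FreeGroup.lift_apply_of (f := KmotData.parabolicGen), ← map_zpow]
  rfl

theorem parabolicRep_x_zpow (ε : ℤˣ) :
    parabolicRep (FreeGroup.of KmotGen.x ^ (ε : ℤ)) = !![1, C (ε : ℤ); 0, 1] := by
  rw [parabolicRep_of_zpow]
  rcases Int.units_eq_one_or ε with rfl | rfl
  · rw [Units.val_one, zpow_one]
    simp [KmotData.parabolicGen, ← Matrix.ext_iff]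
  · rw [Units.val_neg, Units.val_one, zpow_neg_one,
      Matrix.SpecialLinearGroup.coe_inv, Matrix.adjugate_fin_two]
    simp [KmotData.parabolicGen, ← Matrix.ext_iff]

theorem parabolicRep_y_zpow (ε : ℤˣ) :
    parabolicRep (FreeGroup.of KmotGen.y ^ (ε : ℤ)) = !![1, 0; -(C (ε : ℤ) * X ^ 2), 1] := by
  rw [parabolicRep_of_zpow]
  rcases Int.units_eq_one_or ε with rfl | rfl
  · rw [Units.val_one, zpow_one]
    simp [KmotData.parabolicGen, ← Matrix.ext_iff]
  · rw [Units.val_neg, Units.val_one, zpow_neg_one,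
      Matrix.SpecialLinearGroup.coe_inv, Matrix.adjugate_fin_two]
    simp [KmotData.parabolicGen, ← Matrix.ext_iff]

/-- The matrix `S⁻ᵏ diag(u, 1)` with `S = (0 -1; 1 0)`, which intertwines the `k`-th letter (counted
from `0`) of an alternating word `x^± y^± x^± ⋯` with a transfer matrix. -/
noncomputable def intertwiner : ℕ → Matrix (Fin 2) (Fin 2) ℤ[X]
  | 0 => !![X, 0; 0, 1]
  | 1 => !![0, 1; -X, 0]
  | k + 2 => -intertwiner k

theorem intertwiner_two_mul (m : ℕ) : intertwiner (2 * m) = (-1 : ℤ[X]) ^ m • !![X, 0; 0, 1] := by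
  induction m with
  | zero => simp [intertwiner]
  | succ m ih => rw [mul_add_one, intertwiner, ih, pow_succ, mul_neg_one, neg_smul]

theorem intertwiner_mul_parabolicRep (k : ℕ) (ε : ℤˣ) :
    intertwiner k *
        parabolicRep (FreeGroup.of (if Even k then KmotGen.x else KmotGen.y) ^ (ε : ℤ)) =
      transferMatrix ε * intertwiner (k + 1) := by
  induction k using Nat.twoStepInduction with
  | zero => simp [intertwiner, transferMatrix, parabolicRep_x_zpow, mul_comm]
  | one => simp [intertwiner, transferMatrix, parabolicRep_y_zpow, pow_two, mul_assoc]
  | more k ih _ =>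
    have hk : Even (k + 2) ↔ Even k := by simp [Nat.even_add]
    simp only [intertwiner, hk, neg_mul, mul_neg, ih]

theorem intertwiner_zero_mul_parabolicRep_prod {k : ℕ} (s : Fin k → ℤˣ) :
    intertwiner 0 * parabolicRep (List.ofFn fun i : Fin k =>
        FreeGroup.of (if Even (i : ℕ) then KmotGen.x else KmotGen.y) ^ (s i : ℤ)).prod =
      (List.ofFn fun i => transferMatrix (s i)).prod * intertwiner k := by
  induction k with
  | zero => simp
  | succ k ih =>
    simp only [List.ofFn_succ_last, List.prod_append, List.prod_singleton, map_mul,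
      Fin.val_castSucc, Fin.val_last]
    rw [← mul_assoc, ih, mul_assoc, intertwiner_mul_parabolicRep, ← mul_assoc]

theorem comp_neg_X_sq_rileyPolynomial (D : KmotData) :
    D.rileyPolynomial.comp (-X ^ 2) =
      (-1) ^ (D.α / 2) * (List.ofFn fun i => transferMatrix (D.sign i)).prod 0 0 := by
  set T := (List.ofFn fun i => transferMatrix (D.sign i)).prod
  have hα : D.α - 1 = 2 * (D.α / 2) := by have := D.odd_α; grind
  have h : intertwiner 0 * parabolicRep D.word = T * intertwiner (D.α - 1) :=
    intertwiner_zero_mul_parabolicRep_prod D.sign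
  rw [hα, intertwiner_two_mul] at h
  have h₀₀ : X * parabolicRep D.word 0 0 = T 0 0 * ((-1) ^ (D.α / 2) * X) := by
    simpa [intertwiner, Matrix.mul_apply, Fin.sum_univ_two] using congrFun₂ h 0 0
  change parabolicRep D.word 0 0 = _
  exact mul_left_cancel₀ X_ne_zero (h₀₀.trans (by ring))

theorem comp_neg_X_sq_rileyPolynomial_ofHalf (n : ℕ) (hn : 1 ≤ n) (e : ℕ → ℤˣ) :
    (KmotData.ofHalf n hn e).rileyPolynomial.comp (-X ^ 2) =
      epsV e n * (epsV e n).comp (-X) := by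
  have hα : (KmotData.ofHalf n hn e).α / 2 = n := by
    change (2 * n + 1) / 2 = n
    omega
  have hprod : (List.ofFn fun i => transferMatrix ((KmotData.ofHalf n hn e).sign i)).prod =
      palindromicTransfer e n := prod_ofFn_transferMatrix_palindrome e n
  rw [comp_neg_X_sq_rileyPolynomial, hα, hprod, palindromicTransfer_apply_zero_zero, ← mul_assoc,
    ← mul_pow]
  simp

end Riley

theorem mainTheorem4 (n : ℕ) (hn : 1 ≤ n) (e : ℕ → ℤˣ) :
    Irreducible (KmotData.ofHalf n hn e).rileyPolynomial ↔ Irreducible (epsV e n) :=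
  irreducible_iff_of_comp_neg_X_sq_eq (comp_neg_X_sq_rileyPolynomial_ofHalf n hn e)
    (comp_neg_X_epsV_ne hn e)
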